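/- Let $r:\mathbb{R}\to[0,\infty)$ be bounded, measurable and compactly supported with $\int_{\mathbb R} r(x)\,dx=1$; let $c=(c(n))_{n\in\mathbb{Z}}$ be a bounded real sequence, $d=(d_n)_{n\in\mathbb{Z}}$ a bounded sequence of positive reals, and $a=(a(n))_{n\in\mathbb{Z}}$ a bounded real sequence with $a(n)\ge\delta$ for all $n$, for some $\delta>0$. Put $r_n(x)=d_n^{-1}r(d_n^{-1}x)$, $M_n=\sup\{|E|:E\in\operatorname{supp} r_n\}$, $I_n=[c(n)-M_n,c(n)+M_n]$ and $\Omega=\prod_{n\in\mathbb{Z}}I_n$, and let $\mu$ be the product probability measure $\prod_{n\in\mathbb{Z}}r_n(x_n-c(n))\,dx_n$ on $\Omega$. For $\omega\in\Omega$ let $J_\omega$ be the bounded self-adjoint operator on $\ell^2(\mathbb{Z})$ given by $$(J_\omega\phi)(n)=a(n)\phi(n+1)+a(n-1)\phi(n-1)+\omega(n)\phi(n),$$ let $\delta_n$ denote the standard basis vectors of $\ell^2(\mathbb{Z})$, and set $$a(m,n)=\int_\Omega\Big(\sup_{t\in\mathbb{R}}\big|\langle\delta_m,e^{-itJ_\omega}\delta_n\rangle\big|\Big)\,d\mu(\omega),\qquad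 m,n\in\mathbb{Z}.$$ **Theorem 2.5.** Suppose that there exist constants $C''>0$ and $\tau>\tfrac32$ such that $$\max_{n\in\{0,1\}}a(m,n)\le\frac{C''}{|m|^{\tau}}\qquad\text{for all } m\in\mathbb{Z}\setminus\{0\}.$$ Then for $\mu$-almost every $\omega\in\Omega$ the operator $J_\omega$ has purely pure point spectrum, that is, for every $\varphi\in\ell^2(\mathbb{Z})$ the spectral measure of $J_\omega$ and $\varphi$ is a pure point measure (it is carried by a countable set). -/

import Mathlib

open MeasureTheory
open scoped ENNReal CompactlySupported

noncomputable section

namespace RandomJacobi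

/-! ### Jacobi operators on `ℓ²(ℤ)` -/

/-- The Hilbert space `ℓ²(ℤ)` of square-summable complex sequences. -/
abbrev ell2 : Type := lp (fun _ : ℤ => ℂ) 2

/-- The standard basis vector `δ_n` of `ℓ²(ℤ)`. -/
def delta (n : ℤ) : ell2 := lp.single 2 n (1 : ℂ)

/-- A bounded real sequence indexed by `ℤ`. -/
def BoundedSeq (v : ℤ → ℝ) : Prop := BddAbove (Set.range fun n => |v n|)

theorem memlp_mul_comp {v : ℤ → ℝ} (hv : BoundedSeq v) (e : ℤ ≃ ℤ) (φ : ell2) :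
    Memℓp (fun n => (v n : ℂ) * φ (e n)) 2 := by
  obtain ⟨B, hB⟩ := hv
  have hB' : ∀ n, |v n| ≤ B := fun n => hB ⟨n, rfl⟩
  have h2 : (0 : ℝ) < (2 : ℝ≥0∞).toReal := by norm_num
  have hs : Summable fun n => ‖φ n‖ ^ (2 : ℝ≥0∞).toReal := (memℓp_gen_iff h2).1 (lp.memℓp φ)
  have hs' : Summable fun n => B ^ 2 * ‖φ (e n)‖ ^ (2 : ℝ≥0∞).toReal :=
    ((e.summable_iff (f := fun n => ‖φ n‖ ^ (2 : ℝ≥0∞).toReal)).2 hs).mul_left _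
  refine memℓp_gen (hs'.of_nonneg_of_le (fun n => by positivity) fun n => ?_)
  rw [norm_mul, Complex.norm_real, Real.norm_eq_abs]
  simp only [ENNReal.toReal_ofNat, Real.rpow_ofNat, mul_pow]
  gcongr
  exact hB' n

theorem boundedSeq_shift {a : ℤ → ℝ} (ha : BoundedSeq a) : BoundedSeq fun n => a (n - 1) := by
  obtain ⟨B, hB⟩ := ha
  exact ⟨B, by rintro _ ⟨n, rfl⟩; exact hB ⟨n - 1, rfl⟩⟩

theorem memlp_jacobi {a b : ℤ → ℝ} (ha : BoundedSeq a) (hb : BoundedSeq b) (φ : ell2) :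
    Memℓp (fun n => (a n : ℂ) * φ (n + 1) + (a (n - 1) : ℂ) * φ (n - 1) + (b n : ℂ) * φ n) 2 :=
  ((memlp_mul_comp ha (Equiv.addRight 1) φ).add
    (memlp_mul_comp (boundedSeq_shift ha) (Equiv.subRight 1) φ)).add
    (memlp_mul_comp hb (Equiv.refl ℤ) φ)

/-- The Jacobi operator with bounded real coefficients `a`, `b`, as a linear map:
`(J φ)(n) = a(n) φ(n+1) + a(n-1) φ(n-1) + b(n) φ(n)`. -/
def jacobiLin {a b : ℤ → ℝ} (ha : BoundedSeq a) (hb : BoundedSeq b) : ell2 →ₗ[ℂ] ell2 where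
  toFun φ :=
    ⟨fun n => (a n : ℂ) * φ (n + 1) + (a (n - 1) : ℂ) * φ (n - 1) + (b n : ℂ) * φ n,
      memlp_jacobi ha hb φ⟩
  map_add' φ ψ := by
    ext n
    simp only [lp.coeFn_add, Pi.add_apply]
    ring
  map_smul' z φ := by
    ext n
    simp only [lp.coeFn_smul, Pi.smul_apply, smul_eq_mul, RingHom.id_apply]
    ring

theorem jacobiLin_isSymmetric {a b : ℤ → ℝ} (ha : BoundedSeq a) (hb : BoundedSeq b) :
    (jacobiLin ha hb).IsSymmetric := by
  intro φ ψ
  let up : ell2 → ell2 := fun χ => ⟨_, memlp_mul_comp ha (Equiv.addRight 1) χ⟩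
  let dn : ell2 → ell2 := fun χ =>
    ⟨_, memlp_mul_comp (boundedSeq_shift ha) (Equiv.subRight 1) χ⟩
  let dg : ell2 → ell2 := fun χ => ⟨_, memlp_mul_comp hb (Equiv.refl ℤ) χ⟩
  have hJ : ∀ χ, jacobiLin ha hb χ = up χ + dn χ + dg χ := fun χ => rfl
  have key : ∀ χ η : ell2, inner ℂ (up χ) η = inner ℂ χ (dn η) := by
    intro χ η
    rw [lp.inner_eq_tsum, lp.inner_eq_tsum, ← (Equiv.addRight (1 : ℤ)).tsum_eq]
    rw [← (Equiv.addRight (1 : ℤ)).tsum_eq (fun i => inner ℂ (χ i) (dn η i))]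
    rw [(Equiv.addRight (1 : ℤ)).tsum_eq (fun i => inner ℂ (up χ i) (η i))]
    refine tsum_congr fun n => ?_
    simp [up, dn]
    ring
  have keyd : inner ℂ (dg φ) ψ = inner ℂ φ (dg ψ) := by
    rw [lp.inner_eq_tsum, lp.inner_eq_tsum]
    refine tsum_congr fun n => ?_
    simp [dg]
    ring
  have key' : inner ℂ (dn φ) ψ = inner ℂ φ (up ψ) := by
    rw [← inner_conj_symm, ← key ψ φ, inner_conj_symm]
  rw [hJ, hJ, inner_add_left, inner_add_left, inner_add_right, inner_add_right, key, key', keyd]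
  ring

/-- The Jacobi operator with bounded real coefficients, as a bounded operator on `ℓ²(ℤ)`
(an everywhere defined symmetric operator is bounded). -/
def jacobi {a b : ℤ → ℝ} (ha : BoundedSeq a) (hb : BoundedSeq b) : ell2 →L[ℂ] ell2 :=
  ⟨jacobiLin ha hb, (jacobiLin_isSymmetric ha hb).continuous⟩

theorem jacobi_apply {a b : ℤ → ℝ} (ha : BoundedSeq a) (hb : BoundedSeq b) (φ : ell2) (n : ℤ) :
    jacobi ha hb φ n =
      (a n : ℂ) * φ (n + 1) + (a (n - 1) : ℂ) * φ (n - 1) + (b n : ℂ) * φ n := rfl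

theorem jacobi_isSelfAdjoint {a b : ℤ → ℝ} (ha : BoundedSeq a) (hb : BoundedSeq b) :
    IsSelfAdjoint (jacobi ha hb) :=
  ContinuousLinearMap.isSelfAdjoint_iff_isSymmetric.2 (jacobiLin_isSymmetric ha hb)

/-- The unitary group `e^{-itT}` of a bounded operator `T`. -/
def evolution (T : ell2 →L[ℂ] ell2) (t : ℝ) : ell2 →L[ℂ] ell2 :=
  NormedSpace.exp ((-(Complex.I * (t : ℂ))) • T)

/-! ### Spectral measures and pure point spectrum -/

section SpectralMeasure

variable {H : Type*} [NormedAddCommGroup H] [InnerProductSpace ℂ H] [CompleteSpace H]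

/-- The positive functional `f ↦ ⟨φ, f(T) φ⟩` on continuous functions on the (compact) spectrum
of the self-adjoint operator `T`, where `f(T)` is given by the continuous functional calculus. -/
def spectralFunctional (T : H →L[ℂ] H) (hT : IsSelfAdjoint T) (φ : H) :
    C_c(spectrum ℝ T, ℝ) →ₚ[ℝ] ℝ :=
  PositiveLinearMap.mk₀
    { toFun := fun f => (inner ℂ φ (cfcHom (R := ℝ) hT f.toContinuousMap φ)).re
      map_add' := fun f g => by
        have : (f + g).toContinuousMap = f.toContinuousMap + g.toContinuousMap := rfl
        simp [this]
      map_smul' := fun c f => by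
        have : (c • f).toContinuousMap = c • f.toContinuousMap := rfl
        rw [this, map_smul]
        simp [inner_smul_right_eq_smul] }
    (fun f hf => by
      have h : 0 ≤ cfcHom (R := ℝ) hT f.toContinuousMap :=
        (cfcHom_nonneg_iff hT).2 fun x => hf x
      have h' := (ContinuousLinearMap.nonneg_iff_isPositive _).1 h
      simpa using (Complex.le_def.1 (h'.inner_nonneg_right φ)).1)

/-- The spectral measure of the self-adjoint operator `T` and the vector `φ`: the Borel measure
`ν` on `ℝ`, carried by the spectrum of `T`, with `∫ f dν = ⟨φ, f(T) φ⟩` for all continuous `f`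
(it is given by the Riesz-Markov-Kakutani theorem). -/
def spectralMeasure (T : H →L[ℂ] H) (hT : IsSelfAdjoint T) (φ : H) : Measure ℝ :=
  (RealRMK.rieszMeasure (spectralFunctional T hT φ)).map Subtype.val

/-- The defining property of the spectral measure. -/
theorem integral_spectralMeasure (T : H →L[ℂ] H) (hT : IsSelfAdjoint T) (φ : H)
    {f : ℝ → ℝ} (hf : Continuous f) :
    ∫ x, f x ∂(spectralMeasure T hT φ) = (inner ℂ φ (cfc f T φ)).re := by
  let g : C_c(spectrum ℝ T, ℝ) :=
    ⟨⟨fun x => f x, by fun_prop⟩, HasCompactSupport.of_compactSpace _⟩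
  have h := RealRMK.integral_rieszMeasure (spectralFunctional T hT φ) g
  rw [spectralMeasure, integral_map (by fun_prop) hf.aestronglyMeasurable, cfc_apply f T hT]
  exact h

/-- A measure on `ℝ` is pure point if it is carried by a countable set. -/
def IsPurePointMeasure (ν : Measure ℝ) : Prop := ∃ S : Set ℝ, S.Countable ∧ ν Sᶜ = 0

/-- A self-adjoint operator has purely pure point spectrum if all of its spectral measures are
pure point measures. -/
def HasPurelyPurePointSpectrum (T : H →L[ℂ] H) (hT : IsSelfAdjoint T) : Prop :=
  ∀ φ : H, IsPurePointMeasure (spectralMeasure T hT φ)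

end SpectralMeasure

/-! ### The random model -/

/-- The data of the model: off-diagonal coefficients `a`, background potential `c`, damping
sequence `d` and single-site density `r`. -/
structure Model where
  a : ℤ → ℝ
  c : ℤ → ℝ
  d : ℤ → ℝ
  r : ℝ → ℝ
  a_bdd : BoundedSeq a
  a_lower : ∃ δ : ℝ, 0 < δ ∧ ∀ n, δ ≤ a n
  c_bdd : BoundedSeq c
  d_bdd : BoundedSeq d
  d_pos : ∀ n, 0 < d n
  r_nonneg : ∀ x, 0 ≤ r x
  r_bdd : ∃ B : ℝ, ∀ x, r x ≤ B
  r_measurable : Measurable r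
  r_compact : HasCompactSupport r
  r_integral : ∫ x, r x = 1

namespace Model

variable (P : Model)

/-- `r_n(x) = d_n⁻¹ r(d_n⁻¹ x)`. -/
def rn (n : ℤ) (x : ℝ) : ℝ := (P.d n)⁻¹ * P.r ((P.d n)⁻¹ * x)

/-- `M_n = sup {|E| : E ∈ supp r_n}`. -/
def Mn (n : ℤ) : ℝ := sSup ((fun E : ℝ => |E|) '' tsupport (P.rn n))

/-- `I_n = [c(n) - M_n, c(n) + M_n]`. -/
def In (n : ℤ) : Set ℝ := Set.Icc (P.c n - P.Mn n) (P.c n + P.Mn n)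

/-- `Ω = ∏ I_n`. -/
abbrev Om : Type := (n : ℤ) → P.In n

/-- The probability measure `r_n(x - c(n)) dx` on `I_n`. -/
def siteMeasure (n : ℤ) : Measure (P.In n) :=
  (volume.withDensity fun x => ENNReal.ofReal (P.rn n (x - P.c n))).comap Subtype.val

/-- The product measure `μ = ∏ r_n(x_n - c(n)) dx_n` on `Ω`. -/
def prob : Measure P.Om := Measure.infinitePi P.siteMeasure

theorem tsupport_rn_subset (n : ℤ) :
    tsupport (P.rn n) ⊆ (fun x => (P.d n)⁻¹ * x) ⁻¹' tsupport P.r := by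
  refine closure_minimal (fun x hx => subset_tsupport _ ?_)
    ((isClosed_tsupport _).preimage (by fun_prop))
  intro h
  exact hx (by simp [rn, h])

theorem exists_support_bound : ∃ R : ℝ, 0 ≤ R ∧ ∀ x ∈ tsupport P.r, |x| ≤ R := by
  obtain ⟨R, hR⟩ := P.r_compact.isCompact.isBounded.exists_norm_le
  exact ⟨max R 0, le_max_right _ _, fun x hx => (hR x hx).trans (le_max_left _ _)⟩

theorem abs_le_of_mem_tsupport {R : ℝ} (hR : ∀ x ∈ tsupport P.r, |x| ≤ R) {n : ℤ} {x : ℝ}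
    (hx : x ∈ tsupport (P.rn n)) : |x| ≤ P.d n * R := by
  have h := hR _ (P.tsupport_rn_subset n hx)
  rw [abs_mul, abs_of_pos (inv_pos.2 (P.d_pos n))] at h
  rwa [inv_mul_le_iff₀ (P.d_pos n)] at h

theorem Mn_le {R : ℝ} (hR0 : 0 ≤ R) (hR : ∀ x ∈ tsupport P.r, |x| ≤ R) (n : ℤ) :
    P.Mn n ≤ P.d n * R := by
  refine Real.sSup_le ?_ (mul_nonneg (P.d_pos n).le hR0)
  rintro _ ⟨x, hx, rfl⟩
  exact P.abs_le_of_mem_tsupport hR hx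

theorem abs_le_Mn {n : ℤ} {x : ℝ} (hx : x ∈ tsupport (P.rn n)) : |x| ≤ P.Mn n := by
  obtain ⟨R, -, hR⟩ := P.exists_support_bound
  refine le_csSup ⟨P.d n * R, ?_⟩ ⟨x, hx, rfl⟩
  rintro _ ⟨y, hy, rfl⟩
  exact P.abs_le_of_mem_tsupport hR hy

instance siteMeasure_isProbability (n : ℤ) : IsProbabilityMeasure (P.siteMeasure n) := by
  constructor
  have hint : ∫ x, P.rn n (x - P.c n) = 1 := by
    rw [integral_sub_right_eq_self (fun x => P.rn n x) (P.c n)]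
    simp only [rn]
    rw [integral_const_mul, Measure.integral_comp_mul_left, P.r_integral, inv_inv,
      abs_of_pos (P.d_pos n), smul_eq_mul, mul_one, inv_mul_cancel₀ (P.d_pos n).ne']
  have hI : Integrable fun x => P.rn n (x - P.c n) := by
    by_contra h
    rw [integral_undef h] at hint
    exact zero_ne_one hint
  have hnn : ∀ x, 0 ≤ P.rn n x := fun x =>
    mul_nonneg (inv_pos.2 (P.d_pos n)).le (P.r_nonneg _)
  have hmI : MeasurableSet (P.In n) := measurableSet_Icc
  have hind : (P.In n).indicator (fun x => ENNReal.ofReal (P.rn n (x - P.c n))) =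
      fun x => ENNReal.ofReal (P.rn n (x - P.c n)) := by
    refine Set.indicator_eq_self.2 fun x hx => ?_
    have hx' : P.rn n (x - P.c n) ≠ 0 := fun h0 => hx (by simp [h0])
    have hb := abs_le.1 (P.abs_le_Mn (subset_tsupport _ hx'))
    exact ⟨by linarith [hb.1], by linarith [hb.2]⟩
  rw [siteMeasure, (MeasurableEmbedding.subtype_coe hmI).comap_apply, Set.image_univ,
    Subtype.range_coe, withDensity_apply _ hmI, ← lintegral_indicator hmI, hind,
    ← ofReal_integral_eq_lintegral_ofReal hI (Filter.Eventually.of_forall fun x => hnn _),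
    hint, ENNReal.ofReal_one]

instance prob_isProbability : IsProbabilityMeasure P.prob := by
  unfold prob
  infer_instance

/-- The random potential `b_ω(n) = ω(n)`. -/
def potential (ω : P.Om) (n : ℤ) : ℝ := (ω n : ℝ)

theorem potential_bdd (ω : P.Om) : BoundedSeq (P.potential ω) := by
  obtain ⟨R, hR0, hR⟩ := P.exists_support_bound
  obtain ⟨C, hC⟩ := P.c_bdd
  obtain ⟨D, hD⟩ := P.d_bdd
  refine ⟨C + D * R, ?_⟩
  rintro _ ⟨n, rfl⟩
  have h1 : |P.c n| ≤ C := hC ⟨n, rfl⟩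
  have h2 : |P.d n| ≤ D := hD ⟨n, rfl⟩
  have h3 := P.Mn_le hR0 hR n
  have h4 : P.d n * R ≤ D * R := mul_le_mul_of_nonneg_right ((le_abs_self _).trans h2) hR0
  obtain ⟨h5, h6⟩ := (ω n).2
  have h7 := abs_le.1 h1
  exact abs_le.2 ⟨by simp only [potential]; linarith, by simp only [potential]; linarith⟩

/-- The random Jacobi operator `J_ω`. -/
def J (ω : P.Om) : ell2 →L[ℂ] ell2 := jacobi P.a_bdd (P.potential_bdd ω)

theorem J_isSelfAdjoint (ω : P.Om) : IsSelfAdjoint (P.J ω) :=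
  jacobi_isSelfAdjoint P.a_bdd (P.potential_bdd ω)

/-- `a(m,n) = ∫ sup_{t ∈ ℝ} |⟨δ_m, e^{-itJ_ω} δ_n⟩| dμ(ω)`, as an element of `[0,∞]`. -/
def amp (m n : ℤ) : ℝ≥0∞ :=
  ∫⁻ ω, ⨆ t : ℝ, ENNReal.ofReal ‖(inner ℂ (delta m) (evolution (P.J ω) t (delta n)) : ℂ)‖ ∂P.prob

end Model

end RandomJacobi

end

open Filter Topology Set RandomJacobi

/-! The decay in `m` is summable, so by Tonelli, for almost every ω, the sequence sup_t |⟨δ_m,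
e^{-itJ}δ_n⟩| is summable in `m` for n = 0, 1. The orbit of δ_n is then dominated coordinatewise by
a fixed summable sequence, hence precompact (`totallyBounded_of_norm_apply_le`).

A vector with precompact orbit lies in the closed span V of the eigenvectors
(`mem_closure_eigenSpan_of_totallyBounded`). Otherwise its component z ≠ 0 in Vᗮ also has a
precompact orbit, and the time averages of the projections onto e^{-itT}z have a norm limit point K
that is compact, self-adjoint, nonzero and commutes with T. A nonzero eigenvalue of K has a
finite-dimensional T-invariant eigenspace, which contains an eigenvector of T; but K vanishes on V.

As V is closed and J-invariant and a(n) ≠ 0, having δ₀ and δ₁ in V forces V = ℓ². Finally, vectors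
of V have pure point spectral measures (`isPurePointMeasure_of_mem_closure`). -/

/-- If a curve with totally bounded range satisfies `F' = L F`, then the closed convex hull of its
range contains a zero of `L`, namely a limit point of its time averages. -/
theorem exists_mem_closedConvexHull_apply_eq_zero {E : Type*} [NormedAddCommGroup E]
    [NormedSpace ℝ E] [CompleteSpace E] (L : E →L[ℝ] E) {F : ℝ → E}
    (hF : ∀ t, HasDerivAt F (L (F t)) t) (htb : TotallyBounded (range F)) :
    ∃ K ∈ closedConvexHull ℝ (range F), L K = 0 := by
  have hcont : Continuous F := continuous_iff_continuousAt.2 fun t => (hF t).continuousAt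
  have hcpt : IsCompact (closedConvexHull ℝ (range F)) := by
    rw [closedConvexHull_eq_closure_convexHull]
    exact htb.convexHull.closure.isCompact_of_isClosed isClosed_closure
  -- The length `n + 1` keeps the interval of positive measure, so that the averages stay in the
  -- hull.
  let k : ℕ → E := fun n => ⨍ t in Ioc (0 : ℝ) (n + 1), F t
  have hk : ∀ n, k n ∈ closedConvexHull ℝ (range F) := fun n =>
    convex_closedConvexHull.set_average_mem isClosed_closedConvexHull
      (by simp; positivity) (by simp) (Eventually.of_forall fun t =>
        subset_closedConvexHull (mem_range_self t)) (hcont.integrableOn_Ioc)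
  obtain ⟨K, hK, φ, hφ, hlim⟩ := hcpt.tendsto_subseq hk
  refine ⟨K, hK, ?_⟩
  -- Since `L (F t)` is the derivative of `F`, only boundary terms remain; they are bounded and
  -- divided by `n + 1`.
  have hLk : ∀ n : ℕ, L (k n) = ((n : ℝ) + 1)⁻¹ • (F (n + 1) - F 0) := fun n => by
    have hpos : (0 : ℝ) ≤ n + 1 := by positivity
    have h1 : ∫ t in (0 : ℝ)..(n + 1), L (F t) = F (n + 1) - F 0 :=
      intervalIntegral.integral_eq_sub_of_hasDerivAt (fun t _ => hF t)
        ((L.continuous.comp hcont).intervalIntegrable _ _)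
    rw [← h1, intervalIntegral.integral_of_le hpos,
      L.integral_comp_comm hcont.integrableOn_Ioc]
    simp [k, setAverage_eq, hpos]
  obtain ⟨B, hB⟩ := htb.isBounded.exists_norm_le
  have hB' : ∀ t, ‖F t‖ ≤ B := fun t => hB _ (mem_range_self t)
  have hzero : Tendsto (fun n => L (k n)) atTop (𝓝 0) := by
    refine squeeze_zero_norm (a := fun n : ℕ => ((n : ℝ) + 1)⁻¹ * (B + B)) (fun n => ?_) ?_
    · rw [hLk, norm_smul, norm_inv, Real.norm_of_nonneg (by positivity : (0 : ℝ) ≤ n + 1)]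
      gcongr
      exact (norm_sub_le _ _).trans (add_le_add (hB' _) (hB' _))
    · have := (tendsto_one_div_add_atTop_nhds_zero_nat (𝕜 := ℝ)).mul_const (B + B)
      simpa using this
  exact tendsto_nhds_unique ((L.continuous.tendsto K).comp hlim) (hzero.comp hφ.tendsto_atTop)

/-! ### Unitary groups, precompact orbits and eigenvectors -/

section Hilbert

variable {H : Type*} [NormedAddCommGroup H] [InnerProductSpace ℂ H] [CompleteSpace H]

/-- The unitary group `t ↦ e^{-itT}` of a bounded self-adjoint operator. -/
noncomputable def propagator (T : H →L[ℂ] H) (t : ℝ) : H →L[ℂ] H :=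
  NormedSpace.exp ((-(Complex.I * (t : ℂ))) • T)

theorem propagator_eq_exp_smul (T : H →L[ℂ] H) (t : ℝ) :
    propagator T t = NormedSpace.exp (t • (-Complex.I • T)) := by
  rw [propagator, ← smul_assoc]
  congr 2
  simp [mul_comm]

theorem continuous_propagator (T : H →L[ℂ] H) : Continuous (propagator T) := by
  rw [funext (propagator_eq_exp_smul T)]
  exact (differentiable_exp_smul_const ℝ _).continuous

theorem propagator_neg (T : H →L[ℂ] H) (t : ℝ) :
    propagator T (-t) = NormedSpace.exp (t • -(-Complex.I • T)) := by
  rw [propagator_eq_exp_smul, neg_smul, smul_neg]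

theorem adjoint_propagator {T : H →L[ℂ] H} (hT : IsSelfAdjoint T) (t : ℝ) :
    (propagator T t).adjoint = propagator T (-t) := by
  rw [← ContinuousLinearMap.star_eq_adjoint, propagator, propagator, NormedSpace.star_exp,
    star_smul, hT.star_eq]
  simp

theorem propagator_mem_unitary {T : H →L[ℂ] H} (hT : IsSelfAdjoint T) (t : ℝ) :
    propagator T t ∈ unitary (H →L[ℂ] H) := by
  let _ : NormedAlgebra ℚ (H →L[ℂ] H) := NormedAlgebra.restrictScalars ℚ ℂ _
  refine NormedSpace.exp_mem_unitary_of_mem_skewAdjoint ?_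
  rw [skewAdjoint.mem_iff, star_smul, hT.star_eq]
  simp

theorem norm_propagator_apply {T : H →L[ℂ] H} (hT : IsSelfAdjoint T) (t : ℝ) (x : H) :
    ‖propagator T t x‖ = ‖x‖ :=
  ContinuousLinearMap.norm_map_of_mem_unitary (propagator_mem_unitary hT t) x

theorem Commute.propagator_right {A T : H →L[ℂ] H} (h : Commute A T) (t : ℝ) :
    Commute A (propagator T t) :=
  letI : NormedAlgebra ℚ (H →L[ℂ] H) := NormedAlgebra.restrictScalars ℚ ℂ _
  Commute.exp_right (h.smul_right _)

/-- The conjugation by the unitary group of the projection onto `x`. -/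
noncomputable def evolvedRankOne (T : H →L[ℂ] H) (x : H) (t : ℝ) : H →L[ℂ] H :=
  propagator T t * InnerProductSpace.rankOne ℂ x x * propagator T (-t)

/-- The conjugated form is the one to differentiate; this form shows compactness, positivity and
continuous dependence on the orbit point. -/
theorem evolvedRankOne_eq {T : H →L[ℂ] H} (hT : IsSelfAdjoint T) (x : H) (t : ℝ) :
    evolvedRankOne T x t =
      InnerProductSpace.rankOne ℂ (propagator T t x) (propagator T t x) := by
  ext y
  simp [evolvedRankOne, ← adjoint_propagator hT, ContinuousLinearMap.adjoint_inner_right]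

/-- The generator is the commutator with `-iT`, so its zeros are the operators commuting with `T`.
-/
theorem hasDerivAt_evolvedRankOne (T : H →L[ℂ] H) (x : H) (t : ℝ) :
    HasDerivAt (evolvedRankOne T x)
      ((-Complex.I • T) * evolvedRankOne T x t - evolvedRankOne T x t * (-Complex.I • T)) t := by
  have h1 : evolvedRankOne T x = fun t => NormedSpace.exp (t • (-Complex.I • T)) *
      InnerProductSpace.rankOne ℂ x x * NormedSpace.exp (t • -(-Complex.I • T)) := by
    funext s
    rw [evolvedRankOne, propagator_neg, propagator_eq_exp_smul]
  rw [h1]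
  refine (((hasDerivAt_exp_smul_const' (-Complex.I • T) t).mul_const
    (InnerProductSpace.rankOne ℂ x x)).mul
      (hasDerivAt_exp_smul_const (-(-Complex.I • T)) t)).congr_deriv ?_
  noncomm_ring

theorem totallyBounded_range_evolvedRankOne {T : H →L[ℂ] H} (hT : IsSelfAdjoint T) {x : H}
    (hx : TotallyBounded (range fun t => propagator T t x)) :
    TotallyBounded (range (evolvedRankOne T x)) := by
  have hc : Continuous fun y : H => InnerProductSpace.rankOne ℂ y y := by
    change Continuous fun y : H => ContinuousLinearMap.smulRightL ℂ H H (innerSL ℂ y) y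
    fun_prop
  refine ((hx.closure.isCompact_of_isClosed isClosed_closure).image hc).totallyBounded.subset ?_
  rintro _ ⟨t, rfl⟩
  exact ⟨_, subset_closure (mem_range_self t), (evolvedRankOne_eq hT x t).symm⟩

theorem isCompactOperator_evolvedRankOne {T : H →L[ℂ] H} (hT : IsSelfAdjoint T) (x : H) (t : ℝ) :
    IsCompactOperator (evolvedRankOne T x t) := by
  rw [evolvedRankOne_eq hT, InnerProductSpace.rankOne_def']
  exact (isCompactOperator_of_locallyCompactSpace_rng (M₂ := ℂ)
    (ContinuousLinearMap.toSpanSingleton ℂ _)).comp_clm _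

/-- A nonzero vector with precompact orbit under the unitary group has an associated compact
self-adjoint nonzero operator commuting with `T`: its averaged projection. -/
theorem exists_averaged_rankOne {T : H →L[ℂ] H} (hT : IsSelfAdjoint T) {x : H} (hx0 : x ≠ 0)
    (hx : TotallyBounded (range fun t => propagator T t x)) :
    ∃ K : H →L[ℂ] H, K ∈ closedConvexHull ℝ (range (evolvedRankOne T x)) ∧ Commute T K ∧
      IsCompactOperator K ∧ IsSelfAdjoint K ∧ K ≠ 0 := by
  let X : H →L[ℂ] H := -Complex.I • T
  obtain ⟨K, hK, hLK⟩ := exists_mem_closedConvexHull_apply_eq_zero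
    (ContinuousLinearMap.mul ℝ (H →L[ℂ] H) X - (ContinuousLinearMap.mul ℝ (H →L[ℂ] H)).flip X)
    (F := evolvedRankOne T x) (fun t => hasDerivAt_evolvedRankOne T x t)
    (totallyBounded_range_evolvedRankOne hT hx)
  refine ⟨K, hK, ?_, ?_, ?_, ?_⟩
  · have h1 : X * K = K * X := sub_eq_zero.1 hLK
    have h2 : T = Complex.I • X := by simp [X, smul_smul]
    rw [h2]
    exact Commute.smul_left h1 _
  -- Compactness, and below self-adjointness, are closed convex conditions, so `K` inherits them
  -- from the evolved projections.
  · have hC : closedConvexHull ℝ (range (evolvedRankOne T x)) ⊆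
        {A : H →L[ℂ] H | IsCompactOperator A} := by
      refine closedConvexHull_min ?_ ?_ isClosed_setOfPred_isCompactOperator
      · rintro _ ⟨t, rfl⟩
        exact isCompactOperator_evolvedRankOne hT x t
      · intro A hA B hB a b _ _ _
        exact IsCompactOperator.add (hA.smul a) (hB.smul b)
    exact hC hK
  · have hC : closedConvexHull ℝ (range (evolvedRankOne T x)) ⊆
        {A : H →L[ℂ] H | star A = A} := by
      refine closedConvexHull_min ?_ ?_ (isClosed_eq continuous_star continuous_id)
      · rintro _ ⟨t, rfl⟩
        simp [evolvedRankOne_eq hT, ContinuousLinearMap.star_eq_adjoint]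
      · intro A hA B hB a b _ _ _
        simp only [mem_ofPred_eq] at hA hB ⊢
        rw [star_add, star_smul, star_smul, hA, hB]
        simp
    exact hC hK
  -- To keep the averages away from 0, quadratic forms are summed over a finite `‖x‖ / 2`-net of the
  -- orbit. If ‖z‖ = ‖x‖ and ‖z - y‖ ≤ ‖x‖/2, expanding the square gives Re⟨z, y⟩ ≥ (3/8)‖x‖², hence
  -- a uniform lower bound for `Λ`.
  · have hxpos : 0 < ‖x‖ := norm_pos_iff.2 hx0
    have hr : 0 < ‖x‖ / 2 := by positivity
    obtain ⟨s, -, hsfin, hs⟩ := Metric.finite_approx_of_totallyBounded hx _ hr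
    let Λ : (H →L[ℂ] H) → ℝ := fun A => ∑ y ∈ hsfin.toFinset, (inner ℂ y (A y)).re
    have hC : closedConvexHull ℝ (range (evolvedRankOne T x)) ⊆
        {A : H →L[ℂ] H | (‖x‖ ^ 2 * (3 / 8)) ^ 2 ≤ Λ A} := by
      refine closedConvexHull_min ?_ ?_ (isClosed_le continuous_const (by fun_prop))
      · rintro _ ⟨t, rfl⟩
        obtain ⟨y, hy, hty⟩ := mem_iUnion₂.1 (hs (mem_range_self t))
        rw [Metric.mem_ball, dist_eq_norm] at hty
        set z := propagator T t x with hz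
        have hval : ∀ w : H, (inner ℂ w (evolvedRankOne T x t w)).re = ‖inner ℂ z w‖ ^ 2 := by
          intro w
          rw [evolvedRankOne_eq hT, InnerProductSpace.rankOne_apply, inner_smul_right,
            ← inner_conj_symm w, Complex.mul_conj, Complex.normSq_eq_norm_sq, Complex.ofReal_re]
        have h1 : (inner ℂ y (evolvedRankOne T x t y)).re ≤ Λ (evolvedRankOne T x t) :=
          Finset.single_le_sum (f := fun w => (inner ℂ w (evolvedRankOne T x t w)).re)
            (fun w _ => by rw [hval]; positivity) (hsfin.mem_toFinset.2 hy)
        refine le_trans ?_ h1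
        rw [hval]
        have hzn : ‖z‖ = ‖x‖ := norm_propagator_apply hT t x
        have h2 := norm_sub_sq (𝕜 := ℂ) z y
        have h3 : RCLike.re (inner ℂ z y) ≤ ‖inner ℂ z y‖ := RCLike.re_le_norm _
        have h4 : ‖z - y‖ ^ 2 ≤ (‖x‖ / 2) ^ 2 := by gcongr
        gcongr
        rw [hzn] at h2
        nlinarith [sq_nonneg ‖y‖]
      · intro A hA B hB a b ha hb hab
        simp only [mem_ofPred_eq] at hA hB ⊢
        have : Λ (a • A + b • B) = a * Λ A + b * Λ B := by
          simp only [Λ, Finset.mul_sum, ← Finset.sum_add_distrib]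
          refine Finset.sum_congr rfl fun y _ => ?_
          simp [inner_smul_right_eq_smul]
        rw [this]
        calc _ = a * (‖x‖ ^ 2 * (3 / 8)) ^ 2 + b * (‖x‖ ^ 2 * (3 / 8)) ^ 2 := by
                rw [← add_mul, hab, one_mul]
          _ ≤ _ := by gcongr
    intro h0
    have := hC hK
    rw [h0] at this
    simp only [mem_ofPred_eq, Λ, zero_apply, inner_zero_right,
      Complex.zero_re, Finset.sum_const_zero] at this
    exact absurd this (not_le.2 (by positivity))

/-- The span of the eigenvectors with real eigenvalues. -/
def eigenSpan (T : H →L[ℂ] H) : Submodule ℂ H :=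
  Submodule.span ℂ {v | ∃ l : ℝ, T v = (l : ℂ) • v}

omit [CompleteSpace H] in
theorem apply_mem_eigenSpan {T : H →L[ℂ] H} {v : H} (hv : v ∈ eigenSpan T) :
    T v ∈ eigenSpan T := by
  induction hv using Submodule.span_induction with
  | mem v h =>
    obtain ⟨l, hl⟩ := h
    rw [hl]
    exact Submodule.smul_mem _ _ (Submodule.subset_span ⟨l, hl⟩)
  | zero => simp
  | add v w _ _ hv hw => rw [map_add]; exact add_mem hv hw
  | smul c v _ hv => rw [map_smul]; exact Submodule.smul_mem _ _ hv

omit [CompleteSpace H] in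
theorem apply_mem_closure_eigenSpan {T : H →L[ℂ] H} {v : H}
    (hv : v ∈ (eigenSpan T).topologicalClosure) : T v ∈ (eigenSpan T).topologicalClosure :=
  map_mem_closure T.continuous hv fun _ h => apply_mem_eigenSpan h

/-- Two commuting operators, one of them self-adjoint and the other compact, self-adjoint and
nonzero, have a common eigenvector outside of the kernel of the latter. -/
theorem exists_common_eigenvector {T K : H →L[ℂ] H} (hT : IsSelfAdjoint T) (hTK : Commute T K)
    (hKc : IsCompactOperator K) (hK : IsSelfAdjoint K) (hK0 : K ≠ 0) :
    ∃ v : H, K v ≠ 0 ∧ ∃ l : ℝ, T v = (l : ℂ) • v := by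
  have h := mt (ContinuousLinearMap.eq_zero_of_forall_hasEigenvalue_eq_zero hKc
    (ContinuousLinearMap.isSelfAdjoint_iff_isSymmetric.1 hK)).1 hK0
  push Not at h
  obtain ⟨μ, hμ, hμ0⟩ := h
  have := ContinuousLinearMap.finite_dimensional_eigenspace hKc μ hμ0
  have hinv : ∀ v ∈ Module.End.eigenspace (K : Module.End ℂ H) μ,
      (T : Module.End ℂ H) v ∈ Module.End.eigenspace (K : Module.End ℂ H) μ := by
    intro v hv
    rw [Module.End.mem_eigenspace_iff] at hv ⊢
    have h1 : K (T v) = T (K v) := (DFunLike.congr_fun hTK.eq v).symm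
    change K v = μ • v at hv
    change K (T v) = μ • T v
    rw [h1, hv, map_smul]
  have hnt : Nontrivial (Module.End.eigenspace (K : Module.End ℂ H) μ) :=
    Submodule.nontrivial_iff_ne_bot.2 hμ
  obtain ⟨l, hl⟩ := Module.End.exists_eigenvalue ((T : Module.End ℂ H).restrict hinv)
  obtain ⟨⟨v, hvW⟩, hv⟩ := hl.exists_hasEigenvector
  have hv0 : v ≠ 0 := fun h => hv.2 (Subtype.ext h)
  have hTv : T v = l • v := congrArg Subtype.val hv.apply_eq_smul
  have hreal : (starRingEnd ℂ) l = l :=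
    (ContinuousLinearMap.isSelfAdjoint_iff_isSymmetric.1 hT).conj_eigenvalue_eq_self
      (Module.End.hasEigenvalue_of_hasEigenvector (x := v)
        ⟨Module.End.mem_eigenspace_iff.2 hTv, hv0⟩)
  refine ⟨v, ?_, l.re, ?_⟩
  · have : K v = μ • v := Module.End.mem_eigenspace_iff.1 hvW
    rw [this]
    exact smul_ne_zero hμ0 hv0
  · rw [Complex.conj_eq_iff_re.1 hreal, hTv]

/-- A vector whose orbit under the unitary group is precompact is a limit of linear combinations of
eigenvectors. -/
theorem mem_closure_eigenSpan_of_totallyBounded {T : H →L[ℂ] H} (hT : IsSelfAdjoint T) {x : H}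
    (hx : TotallyBounded (range fun t => propagator T t x)) :
    x ∈ (eigenSpan T).topologicalClosure := by
  set V := (eigenSpan T).topologicalClosure with hV
  have : CompleteSpace V := (Submodule.isClosed_topologicalClosure _).completeSpace_coe
  have hVo : ∀ v ∈ Vᗮ, T v ∈ Vᗮ := fun v hv => by
    rw [Submodule.mem_orthogonal] at hv ⊢
    intro u hu
    rw [← show inner ℂ (T u) v = inner ℂ u (T v) from
      ContinuousLinearMap.isSelfAdjoint_iff_isSymmetric.1 hT u v]
    exact hv _ (apply_mem_closure_eigenSpan hu)
  have hcomm : Commute Vᗮ.starProjection T := by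
    ext y
    change Vᗮ.starProjection (T y) = T (Vᗮ.starProjection y)
    obtain ⟨u, hu, w, hw, rfl⟩ := V.exists_add_mem_mem_orthogonal y
    have e1 := Submodule.starProjection_eq_self_iff.2 hw
    have e2 := Submodule.starProjection_eq_self_iff.2 (hVo w hw)
    have e3 : Vᗮ.starProjection u = 0 :=
      (Submodule.starProjection_apply_eq_zero_iff _).2 (V.le_orthogonal_orthogonal hu)
    have e4 : Vᗮ.starProjection (T u) = 0 :=
      (Submodule.starProjection_apply_eq_zero_iff _).2
        (V.le_orthogonal_orthogonal (apply_mem_closure_eigenSpan hu))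
    simp [map_add, e1, e2, e3, e4]
  by_contra hxV
  -- The orbit of `z` is the projection of the orbit of `x`, so it is precompact too.
  set z := Vᗮ.starProjection x with hz
  have horb : ∀ t, propagator T t z = Vᗮ.starProjection (propagator T t x) := fun t =>
    (DFunLike.congr_fun (hcomm.propagator_right t).eq x).symm
  have hz0 : z ≠ 0 := fun h => hxV <| by
    have := (Submodule.starProjection_apply_eq_zero_iff _).1 h
    rwa [Submodule.orthogonal_orthogonal] at this
  have hztb : TotallyBounded (range fun t => propagator T t z) := by
    have h1 := hx.image Vᗮ.starProjection.uniformContinuous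
    rw [← range_comp] at h1
    refine h1.subset ?_
    rintro _ ⟨t, rfl⟩
    exact ⟨t, (horb t).symm⟩
  obtain ⟨K, hK, hTK, hKc, hKs, hK0⟩ := exists_averaged_rankOne hT hz0 hztb
  obtain ⟨v, hKv, l, hl⟩ := exists_common_eigenvector hT hTK hKc hKs hK0
  have hvV : v ∈ V := subset_closure (Submodule.subset_span ⟨l, hl⟩)
  -- The orbit of `z` stays orthogonal to `v`, so each evolved projection kills `v`, and therefore
  -- so does `K`.
  have hC : closedConvexHull ℝ (range (evolvedRankOne T z)) ⊆ {A : H →L[ℂ] H | A v = 0} := by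
    refine closedConvexHull_min ?_ ?_ (isClosed_eq (by fun_prop) continuous_const)
    · rintro _ ⟨t, rfl⟩
      have h1 : propagator T t z ∈ Vᗮ := by
        rw [horb]
        exact Submodule.starProjection_apply_mem _ _
      have h2 := (Submodule.mem_orthogonal' _ _).1 h1 v hvV
      simp [evolvedRankOne_eq hT, h2]
    · intro A hA B hB a b _ _ _
      simp only [mem_ofPred_eq] at hA hB
      simp [hA, hB]
  exact hKv (hC hK)

end Hilbert

/-! ### Spectral measures of limits of eigenvector combinations -/

section SpectralMeasure

variable {H : Type*} [NormedAddCommGroup H] [InnerProductSpace ℂ H] [CompleteSpace H]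

/-- The continuous functional calculus acts on an eigenvector by the value at the eigenvalue. -/
theorem cfc_apply_eigenvector {T : H →L[ℂ] H} (hT : IsSelfAdjoint T) {v : H} {l : ℝ}
    (hv : T v = (l : ℂ) • v) (f : ℝ → ℝ) (hf : Continuous f) :
    cfc f T v = (f l : ℂ) • v := by
  rcases eq_or_ne v 0 with rfl | hv0
  · simp
  have hl : l ∈ spectrum ℝ T := by
    rw [spectrum.mem_iff]
    rintro ⟨u, hu⟩
    refine hv0 ?_
    have h1 : (u : H →L[ℂ] H) v = 0 := by
      rw [hu]
      simp [hv, Algebra.algebraMap_eq_smul_one]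
    calc v = ((↑u⁻¹ * ↑u : H →L[ℂ] H)) v := by simp
      _ = 0 := by rw [mul_apply_eq_comp, h1, map_zero]
  -- Stone–Weierstrass: the identity holds for constants and the coordinate, and survives sums,
  -- products and uniform limits.
  have key : ∀ g : C(spectrum ℝ T, ℝ), cfcHom (R := ℝ) hT g v = (g ⟨l, hl⟩ : ℂ) • v := by
    intro g
    induction g using ContinuousMap.induction_on_of_compact with
    | const r =>
      have : ContinuousMap.const (spectrum ℝ T) r = algebraMap ℝ C(spectrum ℝ T, ℝ) r := rfl
      rw [this, AlgHomClass.commutes]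
      simp [Algebra.algebraMap_eq_smul_one]
    | id => rw [cfcHom_id]; exact hv
    | star_id => rw [map_star, cfcHom_id, hT.star_eq]; exact hv
    | add f g hf hg => simp [hf, hg, add_smul]
    | mul f g hf hg =>
      rw [map_mul, mul_apply_eq_comp, hg, map_smul, hf, smul_smul, ContinuousMap.mul_apply,
        Complex.ofReal_mul, mul_comm]
    | frequently f hf =>
      have hclosed : IsClosed {g : C(spectrum ℝ T, ℝ) |
          cfcHom (R := ℝ) hT g v = (g ⟨l, hl⟩ : ℂ) • v} := by
        refine isClosed_eq ?_ (by fun_prop)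
        exact (ContinuousLinearMap.apply ℂ H v).continuous.comp (cfcHom_continuous hT)
      exact hclosed.mem_of_frequently_of_tendsto hf tendsto_id
  rw [cfc_apply f T hT hf.continuousOn]
  exact key _

/-- Every finite combination of eigenvectors is annihilated by the functions that vanish on a
suitable finite set. -/
theorem exists_finite_cfc_apply_eq_zero {T : H →L[ℂ] H} (hT : IsSelfAdjoint T) {v : H}
    (hv : v ∈ eigenSpan T) :
    ∃ S : Set ℝ, S.Finite ∧ ∀ f : ℝ → ℝ, Continuous f → EqOn f 0 S → cfc f T v = 0 := by
  induction hv using Submodule.span_induction with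
  | mem v h =>
    obtain ⟨l, hl⟩ := h
    refine ⟨{l}, finite_singleton l, fun f hf h0 => ?_⟩
    rw [cfc_apply_eigenvector hT hl f hf, h0 rfl]
    simp
  | zero => exact ⟨∅, finite_empty, fun f _ _ => map_zero _⟩
  | add v w _ _ hv hw =>
    obtain ⟨S, hS, hS'⟩ := hv
    obtain ⟨S₁, hS₁, hS₁'⟩ := hw
    refine ⟨S ∪ S₁, hS.union hS₁, fun f hf h0 => ?_⟩
    rw [map_add, hS' f hf (h0.mono subset_union_left), hS₁' f hf (h0.mono subset_union_right),
      add_zero]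
  | smul c v _ hv =>
    obtain ⟨S, hS, hS'⟩ := hv
    exact ⟨S, hS, fun f hf h0 => by rw [map_smul, hS' f hf h0, smul_zero]⟩

instance isFiniteMeasure_spectralMeasure (T : H →L[ℂ] H) (hT : IsSelfAdjoint T) (φ : H) :
    IsFiniteMeasure (spectralMeasure T hT φ) := by
  unfold spectralMeasure
  infer_instance

/-- The spectral measure of a compact set avoiding finitely many exceptional points is controlled
by the distance of the vector to the ones supported at these points. -/
theorem spectralMeasure_compact_le {T : H →L[ℂ] H} (hT : IsSelfAdjoint T) (φ : H) {v : H}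
    {S K : Set ℝ} (hS : S.Finite)
    (hv : ∀ f : ℝ → ℝ, Continuous f → EqOn f 0 S → cfc f T v = 0)
    (hK : IsCompact K) (hKS : Disjoint S K) :
    (spectralMeasure T hT φ).real K ≤ ‖φ‖ * ‖φ - v‖ := by
  -- A Urysohn function equal to 0 on `S` and 1 on `K` dominates the indicator of `K`, and its
  -- calculus does not see `v`.
  obtain ⟨f, hf0, hf1, hf01⟩ := exists_continuous_zero_one_of_isClosed hS.isClosed hK.isClosed hKS
  have hint : Integrable f (spectralMeasure T hT φ) :=
    Integrable.of_bound f.continuous.aestronglyMeasurable 1 (Eventually.of_forall fun x => by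
      rw [Real.norm_of_nonneg (hf01 x).1]; exact (hf01 x).2)
  have h1 : (spectralMeasure T hT φ).real K ≤ ∫ x, f x ∂(spectralMeasure T hT φ) := by
    rw [← integral_indicator_one hK.measurableSet]
    refine integral_mono ((integrable_const 1).indicator hK.measurableSet) hint fun x => ?_
    by_cases hx : x ∈ K
    · simp [hx, hf1 hx]
    · simpa [hx] using (hf01 x).1
  refine h1.trans ?_
  rw [integral_spectralMeasure T hT φ f.continuous]
  have h2 : cfc f T φ = cfc f T (φ - v) := by
    rw [map_sub, hv f f.continuous hf0, sub_zero]
  have h3 : ‖cfc f T‖ ≤ 1 := norm_cfc_le zero_le_one fun x _ => by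
    rw [Real.norm_of_nonneg (hf01 x).1]; exact (hf01 x).2
  calc (inner ℂ φ (cfc f T φ)).re ≤ ‖inner ℂ φ (cfc f T φ)‖ := Complex.re_le_norm _
    _ ≤ ‖φ‖ * ‖cfc f T φ‖ := norm_inner_le_norm _ _
    _ ≤ ‖φ‖ * ‖φ - v‖ := by
      rw [h2]
      gcongr
      simpa using (cfc f T).le_of_opNorm_le h3 (φ - v)

/-- The spectral measure of a limit of linear combinations of eigenvectors is pure point. -/
theorem isPurePointMeasure_of_mem_closure {T : H →L[ℂ] H} (hT : IsSelfAdjoint T) {φ : H}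
    (hφ : φ ∈ (eigenSpan T).topologicalClosure) :
    IsPurePointMeasure (spectralMeasure T hT φ) := by
  obtain ⟨u, hu, hlim⟩ := mem_closure_iff_seq_limit.1 hφ
  choose S hSfin hS using fun n => exists_finite_cfc_apply_eq_zero hT (hu n)
  have hcount : (⋃ n, S n).Countable := countable_iUnion fun n => (hSfin n).countable
  refine ⟨⋃ n, S n, hcount, ?_⟩
  -- Inner regularity reduces to compact `K`, which misses every `S n`; the bound ‖φ‖‖φ - u n‖ then
  -- tends to 0.
  rw [hcount.measurableSet.compl.measure_eq_iSup_isCompact]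
  simp only [ENNReal.iSup_eq_zero]
  intro K hKS hK
  rw [← measureReal_eq_zero_iff]
  refine le_antisymm ?_ measureReal_nonneg
  have hle : ∀ n, (spectralMeasure T hT φ).real K ≤ ‖φ‖ * ‖φ - u n‖ := fun n =>
    spectralMeasure_compact_le hT φ (hSfin n) (hS n) hK
      ((disjoint_compl_right.mono_right hKS).mono_left (subset_iUnion S n))
  have hz : Tendsto (fun n => ‖φ‖ * ‖φ - u n‖) atTop (𝓝 0) := by
    simpa using ((tendsto_const_nhds (x := φ)).sub hlim).norm.const_mul ‖φ‖
  exact ge_of_tendsto' hz hle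

end SpectralMeasure

/-! ### Compactness and cyclic vectors in ℓ²(ℤ) -/

section Lattice

theorem inner_delta_left (n : ℤ) (x : ell2) : inner ℂ (delta n) x = x n := by
  simp [delta, lp.inner_single_left]

theorem hasSum_smul_delta (x : ell2) : HasSum (fun n => x n • delta n) x := by
  convert lp.hasSum_single (p := 2) (by simp) x using 2 with n
  rw [delta, ← lp.single_smul]
  simp

/-- A family of `ℓ²` vectors dominated coordinatewise by a summable sequence is precompact. -/
theorem totallyBounded_of_norm_apply_le {s : Set ell2} {g : ℤ → ℝ} (hg : Summable g)
    (hs : ∀ x ∈ s, ∀ n, ‖x n‖ ≤ g n) : TotallyBounded s := by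
  -- `Q` is compact in the product topology, and domination by `g` makes the series `Φ` converge
  -- uniformly on it, hence continuously into ℓ².
  let Q := Set.pi univ fun n => Metric.closedBall (0 : ℂ) (g n)
  have hQ : IsCompact Q := isCompact_univ_pi fun n => isCompact_closedBall _ _
  let Φ : (ℤ → ℂ) → ell2 := fun y => ∑' n, y n • delta n
  have hΦ : ContinuousOn Φ Q := by
    refine continuousOn_tsum (fun n => by fun_prop) hg fun n y hy => ?_
    have h1 : ‖delta n‖ = 1 := by simp [delta]
    rw [norm_smul, h1, mul_one]
    exact mem_closedBall_zero_iff.1 (hy n (mem_univ n))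
  refine (hQ.image_of_continuousOn hΦ).totallyBounded.subset fun x hx => ?_
  exact ⟨fun n => x n, fun n _ => mem_closedBall_zero_iff.2 (hs x hx n),
    (hasSum_smul_delta x).tsum_eq⟩

theorem jacobi_delta {a b : ℤ → ℝ} (ha : BoundedSeq a) (hb : BoundedSeq b) (n : ℤ) :
    jacobi ha hb (delta n) = (a (n - 1) : ℂ) • delta (n - 1) + (a n : ℂ) • delta (n + 1) +
      (b n : ℂ) • delta n := by
  ext k
  rw [jacobi_apply]
  simp only [lp.coeFn_add, lp.coeFn_smul, Pi.add_apply, Pi.smul_apply, smul_eq_mul, delta,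
    lp.single_apply, Pi.single_apply]
  have e1 : k + 1 = n ↔ k = n - 1 := by omega
  have e2 : k - 1 = n ↔ k = n + 1 := by omega
  simp only [e1, e2]
  split_ifs <;> subst_vars <;> first | omega | simp

/-- If the off-diagonal coefficients do not vanish, the vectors `δ₀` and `δ₁` are cyclic. -/
theorem eq_top_of_delta_mem {a b : ℤ → ℝ} (ha : BoundedSeq a) (hb : BoundedSeq b)
    (ha0 : ∀ n, a n ≠ 0) {V : Submodule ℂ ell2} (hV : IsClosed (V : Set ell2))
    (hJ : ∀ x ∈ V, jacobi ha hb x ∈ V) (h0 : delta 0 ∈ V) (h1 : delta 1 ∈ V) : V = ⊤ := by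
  -- The three-term relation is solved for its outermost basis vector.
  have hup : ∀ n, delta (n - 1) ∈ V → delta n ∈ V → delta (n + 1) ∈ V := fun n hm hn => by
    have h2 : (a n : ℂ) • delta (n + 1) = jacobi ha hb (delta n) -
        (a (n - 1) : ℂ) • delta (n - 1) - (b n : ℂ) • delta n := by
      rw [jacobi_delta]; abel
    refine (V.smul_mem_iff (Complex.ofReal_ne_zero.2 (ha0 n))).1 ?_
    rw [h2]
    exact V.sub_mem (V.sub_mem (hJ _ hn) (V.smul_mem _ hm)) (V.smul_mem _ hn)
  have hdn : ∀ n, delta (n + 1) ∈ V → delta n ∈ V → delta (n - 1) ∈ V := fun n hp hn => by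
    have h2 : (a (n - 1) : ℂ) • delta (n - 1) = jacobi ha hb (delta n) -
        (a n : ℂ) • delta (n + 1) - (b n : ℂ) • delta n := by
      rw [jacobi_delta]; abel
    refine (V.smul_mem_iff (Complex.ofReal_ne_zero.2 (ha0 (n - 1)))).1 ?_
    rw [h2]
    exact V.sub_mem (V.sub_mem (hJ _ hn) (V.smul_mem _ hp)) (V.smul_mem _ hn)
  have hall : ∀ n : ℤ, delta n ∈ V ∧ delta (n + 1) ∈ V := fun n => by
    induction n using Int.induction_on with
    | zero => exact ⟨h0, by simpa using h1⟩
    | succ k ih => exact ⟨ih.2, hup _ (by simpa using ih.1) ih.2⟩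
    | pred k ih => exact ⟨hdn _ ih.2 ih.1, by simpa using ih.1⟩
  refine Submodule.eq_top_iff'.2 fun x => ?_
  exact hV.mem_of_tendsto (hasSum_smul_delta x)
    (Eventually.of_forall fun s => V.sum_mem fun n _ => V.smul_mem _ (hall n).1)

theorem evolution_eq_propagator (T : ell2 →L[ℂ] ell2) (t : ℝ) :
    evolution T t = propagator T t := rfl

/-- Summability of the transition amplitudes from `δ_n`, uniformly in time, makes `δ_n` a limit of
linear combinations of eigenvectors. -/
theorem delta_mem_closure_eigenSpan {T : ell2 →L[ℂ] ell2} (hT : IsSelfAdjoint T) {n : ℤ}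
    (h : ∑' m : ℤ, ⨆ t : ℝ,
      ENNReal.ofReal ‖(inner ℂ (delta m) (evolution T t (delta n)) : ℂ)‖ ≠ ∞) :
    delta n ∈ (eigenSpan T).topologicalClosure := by
  refine mem_closure_eigenSpan_of_totallyBounded hT
    (totallyBounded_of_norm_apply_le (ENNReal.summable_toReal h) ?_)
  rintro _ ⟨t, rfl⟩ m
  rw [← ENNReal.ofReal_le_iff_le_toReal (ENNReal.ne_top_of_tsum_ne_top h m)]
  refine le_iSup_of_le t ?_
  rw [inner_delta_left, evolution_eq_propagator]

end Lattice

/-! ### Measurability in ω and the almost sure statement -/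

namespace RandomJacobi.Model

variable (P : Model)

/-- One more factor of J combines rows m - 1, m, m + 1 with measurable coefficients, hence the
induction over all `m` at once. -/
theorem measurable_inner_J_pow (n m : ℤ) (k : ℕ) :
    Measurable fun ω => (inner ℂ (delta m) ((P.J ω ^ k) (delta n)) : ℂ) := by
  induction k generalizing m with
  | zero => simp
  | succ k ih =>
    have : (fun ω => (inner ℂ (delta m) ((P.J ω ^ (k + 1)) (delta n)) : ℂ)) = fun ω =>
        (P.a m : ℂ) * inner ℂ (delta (m + 1)) ((P.J ω ^ k) (delta n)) +
          (P.a (m - 1) : ℂ) * inner ℂ (delta (m - 1)) ((P.J ω ^ k) (delta n)) +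
          ((ω m : ℝ) : ℂ) * inner ℂ (delta m) ((P.J ω ^ k) (delta n)) := by
      funext ω
      simp only [inner_delta_left]
      rw [pow_succ']
      exact jacobi_apply P.a_bdd (P.potential_bdd ω) _ _
    rw [this]
    have hω : Measurable fun ω : P.Om => ((ω m : ℝ) : ℂ) :=
      Complex.measurable_ofReal.comp (measurable_subtype_coe.comp (measurable_pi_apply m))
    exact (((ih _).const_mul _).add ((ih _).const_mul _)).add (hω.mul (ih _))

theorem measurable_inner_evolution (n m : ℤ) (t : ℝ) :
    Measurable fun ω => (inner ℂ (delta m) (evolution (P.J ω) t (delta n)) : ℂ) := by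
  have hs : ∀ ω, HasSum (fun k : ℕ => ((k.factorial : ℂ)⁻¹ * (-(Complex.I * (t : ℂ))) ^ k) *
      (inner ℂ (delta m) ((P.J ω ^ k) (delta n)) : ℂ))
      (inner ℂ (delta m) (evolution (P.J ω) t (delta n))) := fun ω => by
    have h1 := NormedSpace.exp_series_hasSum_exp' (𝕂 := ℂ) ((-(Complex.I * (t : ℂ))) • P.J ω)
    have h2 := ((innerSL ℂ (delta m)).comp (ContinuousLinearMap.apply ℂ ell2 (delta n))).hasSum h1
    refine h2.congr_fun fun k => ?_
    rw [smul_pow, smul_smul, map_smul]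
    rfl
  refine measurable_of_tendsto_metrizable (f := fun N ω => ∑ k ∈ Finset.range N,
    ((k.factorial : ℂ)⁻¹ * (-(Complex.I * (t : ℂ))) ^ k) *
      (inner ℂ (delta m) ((P.J ω ^ k) (delta n)) : ℂ)) (fun N => ?_)
    (tendsto_pi_nhds.2 fun ω => (hs ω).tendsto_sum_nat)
  exact Finset.measurable_sum _ fun k _ => (P.measurable_inner_J_pow n m k).const_mul _

theorem continuous_inner_evolution (T : ell2 →L[ℂ] ell2) (n m : ℤ) :
    Continuous fun t => (inner ℂ (delta m) (evolution T t (delta n)) : ℂ) := by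
  have h : Continuous (evolution T) := continuous_propagator T
  fun_prop

/-- Continuity in `t` reduces the supremum to rational times; this measurability is what Tonelli
requires. -/
theorem measurable_iSup_amplitude (m n : ℤ) :
    Measurable fun ω => ⨆ t : ℝ,
      ENNReal.ofReal ‖(inner ℂ (delta m) (evolution (P.J ω) t (delta n)) : ℂ)‖ := by
  have hq : ∀ ω, (⨆ t : ℝ, ENNReal.ofReal
      ‖(inner ℂ (delta m) (evolution (P.J ω) t (delta n)) : ℂ)‖) = ⨆ q : range ((↑) : ℚ → ℝ), ENNReal.ofReal
      ‖(inner ℂ (delta m) (evolution (P.J ω) q (delta n)) : ℂ)‖ := fun ω => by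
    have hc : Continuous fun t : ℝ => ENNReal.ofReal
        ‖(inner ℂ (delta m) (evolution (P.J ω) t (delta n)) : ℂ)‖ :=
      ENNReal.continuous_ofReal.comp (continuous_inner_evolution _ n m).norm
    exact (Rat.isDenseEmbedding_coe_real.dense.ciSup' hc).symm
  have : Countable (range ((↑) : ℚ → ℝ)) := (countable_range _).to_subtype
  simp only [hq]
  exact Measurable.iSup fun q => ((P.measurable_inner_evolution n m q).norm).ennreal_ofReal

/-- Unitarity gives the bound; it serves for the term `m = 0`, on which the decay assumption is
silent. -/
theorem amp_le_one (m n : ℤ) : P.amp m n ≤ 1 := by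
  calc P.amp m n ≤ ∫⁻ _, 1 ∂P.prob := by
        refine lintegral_mono fun ω => iSup_le fun t => ENNReal.ofReal_le_one.2 ?_
        refine (norm_inner_le_norm _ _).trans ?_
        rw [evolution_eq_propagator, norm_propagator_apply (P.J_isSelfAdjoint ω)]
        simp [delta]
    _ = 1 := by simp

theorem ae_delta_mem_closure_eigenSpan {n : ℤ} {C τ : ℝ} (hτ : 1 < τ)
    (h : ∀ m : ℤ, m ≠ 0 → P.amp m n ≤ ENNReal.ofReal (C / |(m : ℝ)| ^ τ)) :
    ∀ᵐ ω ∂P.prob, delta n ∈ (eigenSpan (P.J ω)).topologicalClosure := by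
  have hsum : ∑' m : ℤ, P.amp m n ≠ ∞ := by
    have hS : Summable fun m : ℤ => C / |(m : ℝ)| ^ τ := by
      refine ((Real.summable_abs_int_rpow hτ).mul_left C).congr fun m => ?_
      rw [Real.rpow_neg (abs_nonneg _), div_eq_mul_inv]
    -- The indicator accounts for `m = 0`, where the quotient has the default value `C / 0 = 0`.
    have hle : ∀ m : ℤ, P.amp m n ≤ (if m = 0 then 1 else 0) +
        ENNReal.ofReal (C / |(m : ℝ)| ^ τ) := fun m => by
      rcases eq_or_ne m 0 with rfl | hm
      · simpa using le_add_right (P.amp_le_one 0 n)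
      · simpa [hm] using h m hm
    refine ne_top_of_le_ne_top ?_ (ENNReal.tsum_le_tsum hle)
    rw [ENNReal.tsum_add, tsum_ite_eq]
    exact ENNReal.add_ne_top.2 ⟨ENNReal.one_ne_top, hS.tsum_ofReal_ne_top⟩
  have hmeas := fun m => P.measurable_iSup_amplitude m n
  unfold amp at hsum
  rw [← lintegral_tsum fun m => (hmeas m).aemeasurable] at hsum
  filter_upwards [ae_lt_top (Measurable.tsum hmeas) hsum] with ω hω
  exact delta_mem_closure_eigenSpan (P.J_isSelfAdjoint ω) hω.ne

end RandomJacobi.Model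

theorem theorem2p5 (P : RandomJacobi.Model) (C τ : ℝ) (hC : 0 < C) (hτ : 3 / 2 < τ)
    (h : ∀ m : ℤ, m ≠ 0 →
      max (P.amp m 0) (P.amp m 1) ≤ ENNReal.ofReal (C / |(m : ℝ)| ^ τ)) :
    ∀ᵐ ω ∂P.prob, RandomJacobi.HasPurelyPurePointSpectrum (P.J ω) (P.J_isSelfAdjoint ω) := by
  have hτ' : 1 < τ := by linarith
  filter_upwards [P.ae_delta_mem_closure_eigenSpan hτ' fun m hm => (le_max_left _ _).trans (h m hm),
    P.ae_delta_mem_closure_eigenSpan hτ' fun m hm => (le_max_right _ _).trans (h m hm)]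
    with ω h0 h1 φ
  obtain ⟨δ, hδ, ha⟩ := P.a_lower
  refine isPurePointMeasure_of_mem_closure (P.J_isSelfAdjoint ω) ?_
  have htop : (eigenSpan (P.J ω)).topologicalClosure = ⊤ :=
    eq_top_of_delta_mem P.a_bdd (P.potential_bdd ω) (fun n => (hδ.trans_le (ha n)).ne')
      (Submodule.isClosed_topologicalClosure _) (fun x hx => apply_mem_closure_eigenSpan hx) h0 h1
  rw [htop]
  exact Submodule.mem_top
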